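/- Let $(x_n)_{n\in\mathbb Z}$ and $(a_n)_{n\in\mathbb Z}$ be two doubly infinite sequences of independent commuting variables, and work in the ring $\mathbb Z[[x_n,a_n \mid n\in\mathbb Z]]$ of formal power series, with the topology of coefficientwise convergence. For $r\in\mathbb Z$, let $h_r(x\,\|\,a)$ be the coefficient of $t^r$ in the power series $$\prod_{i\in\mathbb Z}(1-tx_i)^{-1}\prod_{j\in\mathbb Z}(1+ta_j)$$ (so $h_r(x\,\|\,a)=0$ for $r<0$). Let $\lambda=(\lambda_1,\dots,\lambda_m)$ and $\mu=(\mu_1,\dots,\mu_m)$ be two partitions (entries may be $0$), where $m\ge 0$ is any integer with $m\ge\ell(\lambda)$ and $m\ge\ell(\mu)$, and set $$s_{\lambda/\mu}(x\,\|\,a):=\det\bigl(h_{\lambda_i-\mu_j-i+j}(x\,\|\,a)\bigr)_{1\le i,j\le m}.$$ If $\mu\subseteq\lambda$ (that is, $\mu_i\le\lambda_i$ for all $i$), then $$s_{\lambda/\mu}(x\,\|\,a)=\sum_{T}\ \prod_{s=(i,j)\in\lambda-\mu}\bigl(x_{T(s)}+a_{T(s)+j-i}\bigr),$$ where $\lambda-\mu$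 is the set of cells $(i,j)$ (row $i$, column $j$) with $\mu_i<j\le\lambda_i$, the sum is over all column-strict tableaux $T:\lambda-\mu\to\mathbb Z$ (integer fillings that are weakly increasing along rows from left to right and strictly increasing down columns), and the sum converges unconditionally. If $\mu\not\subseteq\lambda$ (so that there are no tableaux of shape $\lambda-\mu$), then $s_{\lambda/\mu}(x\,\|\,a)=0$. -/

import Mathlib

open scoped MvPowerSeries.WithPiTopology PowerSeries.WithPiTopology

namespace DoublyInfinite

/-- The ring `ℤ⟦x_n, a_n ∣ n ∈ ℤ⟧` of formal power series in two doubly infinite sequences of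
variables. Its topology is that of coefficientwise convergence, each coefficient lying in the
discrete ring `ℤ`. -/
abbrev Ser : Type := MvPowerSeries (ℤ ⊕ ℤ) ℤ

/-- The variable `x_n`. -/
noncomputable def x (n : ℤ) : Ser := MvPowerSeries.X (Sum.inl n)

/-- The variable `a_n`. -/
noncomputable def a (n : ℤ) : Ser := MvPowerSeries.X (Sum.inr n)

/-- The factor `(1 - t x_i)⁻¹`, a power series in `t` over `Ser` (here `t` is `PowerSeries.X`). -/
noncomputable def xFactor (i : ℤ) : PowerSeries Ser :=
  PowerSeries.invOfUnit (1 - PowerSeries.X * PowerSeries.C (x i)) 1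

/-- The factor `1 + t a_j`. -/
noncomputable def aFactor (j : ℤ) : PowerSeries Ser :=
  1 + PowerSeries.X * PowerSeries.C (a j)

/-- The generating series `∏_{i ∈ ℤ} (1 - t x_i)⁻¹ ∏_{j ∈ ℤ} (1 + t a_j)`. Both infinite products
converge unconditionally, see `multipliable_xFactor` and `multipliable_aFactor`. -/
noncomputable def genSeries : PowerSeries Ser :=
  (∏' i : ℤ, xFactor i) * ∏' j : ℤ, aFactor j

/-- `h_r(x ‖ a)`: the coefficient of `t ^ r` in the generating series, for `r ∈ ℤ`
(it is `0` for `r < 0`). -/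
noncomputable def h (r : ℤ) : Ser :=
  if 0 ≤ r then PowerSeries.coeff r.toNat genSeries else 0

/-- The determinant `det (h_{λ_i - μ_j - i + j}(x ‖ a))` of size `m × m`. Partitions are Young
diagrams, with rows and columns numbered from `0`. For `m ≥ ℓ(λ), ℓ(μ)` this is
`s_{λ/μ}(x ‖ a)`. -/
noncomputable def skewSchur (m : ℕ) (lam mu : YoungDiagram) : Ser :=
  Matrix.det (Matrix.of fun i j : Fin m =>
    h ((lam.rowLen i : ℤ) - (mu.rowLen j : ℤ) - (i : ℤ) + (j : ℤ)))

/-- The cells `(i, j)` (row, column) of the skew diagram `λ - μ`. -/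
def skewCells (lam mu : YoungDiagram) : Finset (ℕ × ℕ) := lam.cells \ mu.cells

/-- Column-strict tableaux `T : λ - μ → ℤ`: weakly increasing along each row (from left to right)
and strictly increasing down each column. -/
structure ColumnStrictTableau (lam mu : YoungDiagram) where
  /-- the entry of a cell -/
  entry : {c : ℕ × ℕ // c ∈ skewCells lam mu} → ℤ
  row_weak : ∀ c d, c.1.1 = d.1.1 → c.1.2 ≤ d.1.2 → entry c ≤ entry d
  col_strict : ∀ c d, c.1.2 = d.1.2 → c.1.1 < d.1.1 → entry c < entry d

/-- `(x ∣ a)^T = ∏_{s = (i, j) ∈ λ - μ} (x_{T(s)} + a_{T(s) + j - i})`. -/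
noncomputable def weight {lam mu : YoungDiagram} (T : ColumnStrictTableau lam mu) : Ser :=
  ∏ s : {c : ℕ × ℕ // c ∈ skewCells lam mu},
    (x (T.entry s) + a (T.entry s + (s.1.2 : ℤ) - (s.1.1 : ℤ)))

theorem coeff_mul_factor (d : ℤ ⊕ ℤ →₀ ℕ) (n : ℕ) (v : ℤ ⊕ ℤ) (hv : d v = 0)
    (g u : PowerSeries Ser) :
    MvPowerSeries.coeff d (PowerSeries.coeff n
      (g * (1 + PowerSeries.C (MvPowerSeries.X v : Ser) * u))) =
    MvPowerSeries.coeff d (PowerSeries.coeff n g) := by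
  have e : g * (1 + PowerSeries.C (MvPowerSeries.X v : Ser) * u)
      = g + PowerSeries.C (MvPowerSeries.X v : Ser) * (g * u) := by ring
  rw [e, map_add, map_add, PowerSeries.coeff_C_mul, MvPowerSeries.X,
    MvPowerSeries.coeff_monomial_mul, if_neg, add_zero]
  intro hle
  have := hle v
  simp [hv] at this

theorem multipliable_of_factor (v : ℤ → ℤ ⊕ ℤ) (hv : Function.Injective v)
    (f u : ℤ → PowerSeries Ser)
    (hf : ∀ i, f i = 1 + PowerSeries.C (MvPowerSeries.X (v i) : Ser) * u i) :
    Multipliable f := by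
  classical
  let S : (ℤ ⊕ ℤ →₀ ℕ) → Finset ℤ := fun d => d.support.preimage v hv.injOn
  have key : ∀ d n (T : Finset ℤ), S d ⊆ T →
      MvPowerSeries.coeff d (PowerSeries.coeff n (∏ i ∈ T, f i)) =
      MvPowerSeries.coeff d (PowerSeries.coeff n (∏ i ∈ S d, f i)) := by
    intro d n T hT
    rw [← Finset.union_sdiff_of_subset hT]
    have hd : ∀ W : Finset ℤ, Disjoint (S d) W →
        MvPowerSeries.coeff d (PowerSeries.coeff n (∏ i ∈ S d ∪ W, f i)) =
        MvPowerSeries.coeff d (PowerSeries.coeff n (∏ i ∈ S d, f i)) := by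
      intro W
      induction W using Finset.induction_on with
      | empty => simp
      | insert i W hi ih =>
        intro hdis
        rw [Finset.disjoint_insert_right] at hdis
        have hdv : d (v i) = 0 := by
          by_contra hne
          exact hdis.1 (by simp [S, hne])
        rw [Finset.union_insert, Finset.prod_insert (by simp [hdis.1, hi]), mul_comm, hf i,
          coeff_mul_factor d n (v i) hdv, ih hdis.2]
    exact hd _ Finset.disjoint_sdiff
  let L : ℕ → Ser := fun n d => MvPowerSeries.coeff d (PowerSeries.coeff n (∏ i ∈ S d, f i))
  refine ⟨PowerSeries.mk L, ?_⟩
  rw [HasProd, PowerSeries.WithPiTopology.tendsto_iff_coeff_tendsto]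
  intro n
  rw [MvPowerSeries.WithPiTopology.tendsto_iff_coeff_tendsto]
  intro d
  rw [SummationFilter.unconditional_filter]
  refine tendsto_const_nhds.congr' ?_
  filter_upwards [Filter.eventually_ge_atTop (S d)] with T hT
  rw [key d n T hT, PowerSeries.coeff_mk]
  rfl

theorem multipliable_xFactor : Multipliable xFactor := by
  refine multipliable_of_factor Sum.inl Sum.inl_injective xFactor
    (fun i => PowerSeries.X * xFactor i) fun i => ?_
  have e : (1 - PowerSeries.X * PowerSeries.C (x i)) * xFactor i = 1 :=
    PowerSeries.mul_invOfUnit _ 1 (by simp)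
  have e' : (1 - PowerSeries.X * PowerSeries.C (MvPowerSeries.X (Sum.inl i) : Ser)) * xFactor i = 1
    := e
  linear_combination e'

theorem multipliable_aFactor : Multipliable aFactor := by
  refine multipliable_of_factor Sum.inr Sum.inr_injective aFactor
    (fun _ => PowerSeries.X) fun i => ?_
  rw [aFactor, a, mul_comm]

end DoublyInfinite

namespace DoublyInfinite

/-! The identity is proved first for entries in a finite interval `(lo, lo + n]`, by induction on
`n`, and then passed to the limit.

The finite analogue of `h (q - p)` must remember both `p` and `q`: the cells of a row with contents
`p, …, q - 1` and entries in the interval only involve `a`-indices in `(lo + p, lo + n + q - 1]`.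
With this window, `truncH` satisfies an exact recursion in which the last cell either carries the
largest entry or does not (`truncH_succ`). Iterating it along row `i`, from `λ_i` down to `λ_{i+1}`,
leaves a remainder proportional to row `i + 1` of the matrix. A unitriangular row operation removes
it, and multilinearity expands the determinant over `λ_{i+1} ≤ r_i ≤ λ_i`, that is, over the `ν`
with `λ - ν` a horizontal strip (`det_truncH_succ`).

Tableaux obey the same recursion: the cells holding the largest entry form a horizontal strip
(`sum_weight_boundedTableaux_succ`). Shapes `ν` not containing `μ` contribute nothing, since a block
of zeros kills their determinants (`det_eq_zero_of_not_le`). Hence `det_truncH`.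

Finally the interval becomes `(-N, N]`. The determinants converge by continuity, and each
coefficient sees only finitely many tableaux, so the sum converges unconditionally. -/

open Filter Topology

/-! ### Truncated one-row functions and their recursion -/

/-- The factor `x_k + a_{k+c}` contributed by the entry `k` in a cell of content `c`. -/
noncomputable def cellWeight (k c : ℤ) : Ser := x k + a (k + c)

/-- The part of the generating series with `x`-indices in `(lo, hi]` and `a`-indices in
`(lo', hi']`. -/
noncomputable def truncGenSeries (lo hi lo' hi' : ℤ) : PowerSeries Ser :=
  (∏ i ∈ Finset.Ioc lo hi, xFactor i) * ∏ j ∈ Finset.Ioc lo' hi', aFactor j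

/-- The generating function of the one-row tableaux with entries in `(lo, lo + n]` whose cells have
contents `p, p + 1, …, q - 1`, see `truncH_succ`. -/
noncomputable def truncH (lo : ℤ) (n : ℕ) (p q : ℤ) : Ser :=
  if p ≤ q then
    PowerSeries.coeff (q - p).toNat (truncGenSeries lo (lo + n) (lo + p) (lo + n + q - 1))
  else 0

theorem xFactor_spec (i : ℤ) : (1 - PowerSeries.X * PowerSeries.C (x i)) * xFactor i = 1 :=
  PowerSeries.mul_invOfUnit _ 1 (by simp)

theorem constantCoeff_xFactor (i : ℤ) : PowerSeries.constantCoeff (xFactor i) = 1 := by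
  simp [xFactor, PowerSeries.constantCoeff_invOfUnit]

theorem constantCoeff_aFactor (j : ℤ) : PowerSeries.constantCoeff (aFactor j) = 1 := by
  simp [aFactor]

theorem constantCoeff_truncGenSeries (lo hi lo' hi' : ℤ) :
    PowerSeries.constantCoeff (truncGenSeries lo hi lo' hi') = 1 := by
  simp [truncGenSeries, constantCoeff_xFactor, constantCoeff_aFactor]

theorem coeff_prod_aFactor_eq_zero (s : Finset ℤ) (r : ℕ) (hr : s.card < r) :
    PowerSeries.coeff r (∏ j ∈ s, aFactor j) = 0 := by
  induction s using Finset.induction_on generalizing r with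
  | empty =>
    rw [Finset.prod_empty, PowerSeries.coeff_one, if_neg]
    simp at hr
    omega
  | insert j s hj ih =>
    rw [Finset.card_insert_of_notMem hj] at hr
    obtain ⟨r, rfl⟩ : ∃ r', r = r' + 1 := ⟨r - 1, by omega⟩
    rw [Finset.prod_insert hj, aFactor, add_mul, one_mul, mul_assoc, map_add,
      PowerSeries.coeff_succ_X_mul, PowerSeries.coeff_C_mul, ih _ (by omega), ih _ (by omega)]
    simp

theorem truncH_of_lt (lo : ℤ) (n : ℕ) {p q : ℤ} (hpq : q < p) : truncH lo n p q = 0 :=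
  if_neg (by omega)

theorem truncH_self (lo : ℤ) (n : ℕ) (p : ℤ) : truncH lo n p p = 1 := by
  simp [truncH, constantCoeff_truncGenSeries]

/-- For `p < q` the window holds only `q - p - 1` linear factors, too few to reach degree `q - p`.
-/
theorem truncH_zero (lo p q : ℤ) : truncH lo 0 p q = if p = q then 1 else 0 := by
  rcases lt_trichotomy p q with hpq | rfl | hpq
  · rw [if_neg hpq.ne, truncH, if_pos hpq.le, truncGenSeries]
    simp only [Nat.cast_zero, add_zero, Finset.Ioc_self, Finset.prod_empty, one_mul]
    apply coeff_prod_aFactor_eq_zero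
    rw [Int.card_Ioc]
    omega
  · simp [truncH_self]
  · rw [truncH_of_lt _ _ hpq, if_neg hpq.ne']

theorem truncH_succ (lo : ℤ) (n : ℕ) (p q : ℤ) :
    truncH lo (n + 1) p q =
      truncH lo n p q + cellWeight (lo + n + 1) (q - 1) * truncH lo (n + 1) p (q - 1) := by
  rcases lt_trichotomy p q with hlt | rfl | hlt
  · have e1 : Finset.Ioc lo (lo + (n + 1 : ℕ)) = insert (lo + n + 1) (Finset.Ioc lo (lo + n)) := by
      ext; simp; omega
    have e2 : Finset.Ioc (lo + p) (lo + (n + 1 : ℕ) + q - 1) =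
        insert (lo + n + 1 + (q - 1)) (Finset.Ioc (lo + p) (lo + n + q - 1)) := by
      ext; simp; omega
    have e3 : lo + (n + 1 : ℕ) + (q - 1) - 1 = lo + n + q - 1 := by push_cast; ring
    obtain ⟨r, hr⟩ : ∃ r : ℕ, (q - p).toNat = r + 1 := ⟨(q - p).toNat - 1, by omega⟩
    have hr' : (q - 1 - p).toNat = r := by omega
    rw [truncH, truncH, truncH, if_pos hlt.le, if_pos hlt.le, if_pos (by omega), hr, hr',
      truncGenSeries, truncGenSeries, truncGenSeries, e1, e2, e3,
      Finset.prod_insert (by simp), Finset.prod_insert (by simp), cellWeight]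
    generalize ∏ i ∈ Finset.Ioc lo (lo + n), xFactor i = A
    generalize ∏ j ∈ Finset.Ioc (lo + p) (lo + n + q - 1), aFactor j = B
    -- With `k = lo + n + 1`, this is `xFactor k * (1 + t b) = 1 + t (x_k + b) * xFactor k`, where
    -- `b = a_{k+q-1}`, a consequence of `(1 - t x_k) * xFactor k = 1`.
    have key : xFactor (lo + n + 1) * A * (aFactor (lo + n + 1 + (q - 1)) * B) =
        A * B + PowerSeries.X * (PowerSeries.C (x (lo + n + 1) + a (lo + n + 1 + (q - 1))) *
          (xFactor (lo + n + 1) * A * B)) := by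
      rw [aFactor, map_add]
      linear_combination (A * B) * xFactor_spec (lo + n + 1)
    rw [key, map_add, PowerSeries.coeff_succ_X_mul, PowerSeries.coeff_C_mul]
  · rw [truncH_self, truncH_self, truncH_of_lt _ _ (by omega), mul_zero, add_zero]
  · rw [truncH_of_lt _ _ hlt, truncH_of_lt _ _ hlt, truncH_of_lt _ _ (by omega)]
    simp

/-- Iterates `truncH_succ`; `t` marks where the final run of largest entries starts. When `u` is the
length of row `i + 1`, the argument `u - i - 1` of the remainder is the one labelling that row of
the determinant. -/
theorem truncH_succ_eq_sum (lo : ℤ) (n : ℕ) (p i : ℤ) {u v : ℕ} (huv : u ≤ v) :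
    truncH lo (n + 1) p (v - i) =
      ∑ t ∈ Finset.Icc u v, (∏ j ∈ Finset.Ico t v, cellWeight (lo + n + 1) (j - i)) *
        truncH lo n p (t - i) +
      (∏ j ∈ Finset.Ico u v, cellWeight (lo + n + 1) (j - i)) *
        cellWeight (lo + n + 1) (u - i - 1) * truncH lo (n + 1) p (u - i - 1) := by
  induction v, huv using Nat.le_induction with
  | base => simpa using truncH_succ lo n p (u - i)
  | succ v huv ih =>
    have e : ((v + 1 : ℕ) : ℤ) - i - 1 = v - i := by push_cast; ring
    have hI : Finset.Icc u (v + 1) = insert (v + 1) (Finset.Icc u v) := by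
      ext; simp; omega
    rw [truncH_succ, e, ih, hI,
      Finset.sum_insert (by simp), Finset.Ico_self, Finset.prod_empty,
      Finset.prod_Ico_succ_top huv, mul_add, Finset.mul_sum]
    have e' : ∀ t ∈ Finset.Icc u v,
        (∏ j ∈ Finset.Ico t (v + 1), cellWeight (lo + n + 1) (j - i)) * truncH lo n p (t - i) =
        cellWeight (lo + n + 1) (v - i) *
          ((∏ j ∈ Finset.Ico t v, cellWeight (lo + n + 1) (j - i)) * truncH lo n p (t - i)) := by
      intro t ht
      rw [Finset.prod_Ico_succ_top (Finset.mem_Icc.1 ht).2]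
      ring
    rw [Finset.sum_congr rfl e']
    ring

/-! ### Determinants: a vanishing criterion and the recursion -/

/-- A square matrix with a large enough block of zeros has zero determinant. -/
theorem det_eq_zero_of_block {R : Type*} [CommRing R] {m : ℕ} (A : Matrix (Fin m) (Fin m) R)
    (k : Fin m) (hA : ∀ i j, k ≤ i → j ≤ k → A i j = 0) : A.det = 0 := by
  rw [Matrix.det_apply]
  refine Finset.sum_eq_zero fun σ _ => ?_
  suffices h : ∃ j, j ≤ k ∧ k ≤ σ j by
    obtain ⟨j, hj, hk⟩ := h
    have : ∏ i, A (σ i) i = 0 := Finset.prod_eq_zero (Finset.mem_univ j) (hA _ _ hk hj)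
    rw [this, smul_zero]
  -- Pigeonhole: otherwise `σ` would inject `Iic k` into the smaller set `Iio k`.
  by_contra! hcon
  have hle := Finset.card_le_card_of_injOn (s := Finset.Iic k) (t := Finset.Iio k) σ
    (fun j hj => by simpa using hcon j (by simpa using hj)) σ.injective.injOn
  rw [Fin.card_Iic, Fin.card_Iio] at hle
  omega

theorem det_truncH_succ (lo : ℤ) (n m : ℕ) (p : Fin m → ℤ) (hp : ∀ j, -(m : ℤ) < p j)
    (l : ℕ → ℕ) (hl : Antitone l) (hm : l m = 0) :
    (Matrix.of fun i j : Fin m => truncH lo (n + 1) (p j) ((l i : ℤ) - (i : ℕ))).det =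
      ∑ r ∈ Fintype.piFinset fun i : Fin m => Finset.Icc (l (i + 1)) (l i),
        (∏ i : Fin m, ∏ c ∈ Finset.Ico (r i) (l i), cellWeight (lo + n + 1) ((c : ℤ) - (i : ℕ))) *
          (Matrix.of fun i j : Fin m => truncH lo n (p j) ((r i : ℤ) - (i : ℕ))).det := by
  let E : Matrix (Fin m) (Fin m) Ser :=
    Matrix.of fun i j => truncH lo (n + 1) (p j) ((l i : ℤ) - (i : ℕ))
  let g : Fin m → Ser := fun i =>
    (∏ c ∈ Finset.Ico (l (i + 1)) (l i), cellWeight (lo + n + 1) ((c : ℤ) - (i : ℕ))) *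
      cellWeight (lo + n + 1) ((l (i + 1) : ℤ) - (i : ℕ) - 1)
  -- Left multiplication by `1 - W` subtracts `g i` times row `i + 1` from row `i`.
  let W : Matrix (Fin m) (Fin m) Ser := Matrix.of fun i i' => if (i' : ℕ) = i + 1 then g i else 0
  have hW : (1 - W).det = 1 := by
    rw [Matrix.det_of_isUpperTriangular]
    · simp [W]
    · intro i j hij
      have hij' : (j : ℕ) < i := hij
      simp only [Matrix.sub_apply, W, Matrix.of_apply, Matrix.one_apply]
      rw [if_neg (by rintro rfl; omega), if_neg (by omega), sub_zero]
  have hWE : ((1 - W) * E) = Matrix.of fun i : Fin m => ∑ t ∈ Finset.Icc (l (i + 1)) (l i),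
      fun j => (∏ c ∈ Finset.Ico t (l i), cellWeight (lo + n + 1) ((c : ℤ) - (i : ℕ))) *
        truncH lo n (p j) ((t : ℤ) - (i : ℕ)) := by
    ext1 i j
    have hexp := truncH_succ_eq_sum lo n (p j) (i : ℕ) (hl (Nat.le_succ i))
    have hsum : ∑ i', W i i' * E i' j =
        g i * truncH lo (n + 1) (p j) ((l (i + 1) : ℤ) - (i : ℕ) - 1) := by
      by_cases hi : (i : ℕ) + 1 < m
      · rw [Finset.sum_eq_single (⟨i + 1, hi⟩ : Fin m)]
        · simp only [W, E, Matrix.of_apply, ↓reduceIte]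
          congr 1
          congr 1
          push_cast
          ring
        · intro b _ hb
          simp only [W, Matrix.of_apply]
          rw [if_neg (fun hb' => hb (Fin.ext hb')), zero_mul]
        · simp
      -- The last row has no successor, but its remainder sits at `q = -m < p j`, where `truncH`
      -- vanishes.
      · have hi' : (i : ℕ) + 1 = m := by omega
        have := hp j
        rw [hi', hm, truncH_of_lt _ _ (by push_cast; omega), mul_zero]
        refine Finset.sum_eq_zero fun b _ => ?_
        simp only [W, Matrix.of_apply]
        rw [if_neg (by omega), zero_mul]
    rw [sub_mul, one_mul, Matrix.sub_apply, Matrix.mul_apply, hsum, Matrix.of_apply,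
      Finset.sum_apply]
    simp only [E, Matrix.of_apply, g]
    rw [hexp]
    simp only [Nat.succ_eq_add_one]
    ring
  have hdet : E.det = ((1 - W) * E).det := by rw [Matrix.det_mul, hW, one_mul]
  change E.det = _
  rw [hdet, hWE]
  have := (Matrix.detRowAlternating (R := Ser) (n := Fin m)).toMultilinearMap.map_sum_finset
    (fun i t => fun j => (∏ c ∈ Finset.Ico t (l i), cellWeight (lo + n + 1) ((c : ℤ) - (i : ℕ))) *
        truncH lo n (p j) ((t : ℤ) - (i : ℕ))) (fun i : Fin m => Finset.Icc (l (i + 1)) (l i))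
  refine this.trans (Finset.sum_congr rfl fun r _ => ?_)
  exact Matrix.det_mul_column _ _

/-! ### Tableaux: removing the largest entry -/

theorem mem_skewCells {lam mu : YoungDiagram} {c : ℕ × ℕ} :
    c ∈ skewCells lam mu ↔ c ∈ lam ∧ c ∉ mu := by
  simp [skewCells]

theorem ColumnStrictTableau.ext_entry {lam mu : YoungDiagram} {T T' : ColumnStrictTableau lam mu}
    (hT : ∀ c, T.entry c = T'.entry c) : T = T' := by
  cases T
  cases T'
  congr
  exact funext hT

theorem finite_setOf_entry_mem_Ioc (lam mu : YoungDiagram) (lo hi : ℤ) :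
    {T : ColumnStrictTableau lam mu | ∀ c, T.entry c ∈ Set.Ioc lo hi}.Finite := by
  have hfin : (Set.univ.pi fun _ : {c : ℕ × ℕ // c ∈ skewCells lam mu} => Set.Ioc lo hi).Finite :=
    Set.Finite.pi fun _ => Set.finite_Ioc lo hi
  refine Set.Finite.of_injOn (f := ColumnStrictTableau.entry) (fun T hT => Set.mem_univ_pi.2 hT) ?_ hfin
  intro T _ T' _ h
  exact ColumnStrictTableau.ext_entry (congrFun h)

/-- The column-strict tableaux with entries in `(lo, hi]`. -/
noncomputable def boundedTableaux (lam mu : YoungDiagram) (lo hi : ℤ) :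
    Finset (ColumnStrictTableau lam mu) :=
  (finite_setOf_entry_mem_Ioc lam mu lo hi).toFinset

theorem mem_boundedTableaux {lam mu : YoungDiagram} {lo hi : ℤ} {T : ColumnStrictTableau lam mu} :
    T ∈ boundedTableaux lam mu lo hi ↔ ∀ c, lo < T.entry c ∧ T.entry c ≤ hi := by
  simp [boundedTableaux]

/-- The diagram formed by the cells of `lam` with no entry greater than `k`. -/
def lowShape {lam mu : YoungDiagram} (T : ColumnStrictTableau lam mu) (k : ℤ) : YoungDiagram where
  cells := lam.cells.filter fun c => ∀ hc : c ∈ skewCells lam mu, T.entry ⟨c, hc⟩ ≤ k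
  isLowerSet := by
    intro c d hdc hc
    simp only [Finset.coe_filter, Set.mem_ofPred_eq, YoungDiagram.mem_cells] at hc ⊢
    have hd : d ∈ lam := lam.isLowerSet hdc hc.1
    refine ⟨hd, fun hds => ?_⟩
    have hdmu := (mem_skewCells.1 hds).2
    have hcs : c ∈ skewCells lam mu :=
      mem_skewCells.2 ⟨hc.1, fun h => hdmu (mu.isLowerSet hdc h)⟩
    -- Entries at `d` and `c` are compared through the corner cell in the row of `d` and the column
    -- of `c`, which also lies in the skew shape.
    have hes : (d.1, c.2) ∈ skewCells lam mu :=
      mem_skewCells.2 ⟨lam.isLowerSet (show ((d.1, c.2) : ℕ × ℕ) ≤ c from ⟨hdc.1, le_rfl⟩) hc.1,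
        fun h => hdmu (mu.isLowerSet (show d ≤ ((d.1, c.2) : ℕ × ℕ) from ⟨le_rfl, hdc.2⟩) h)⟩
    have h1 : T.entry ⟨d, hds⟩ ≤ T.entry ⟨(d.1, c.2), hes⟩ := T.row_weak _ _ rfl hdc.2
    have h2 : T.entry ⟨(d.1, c.2), hes⟩ ≤ T.entry ⟨c, hcs⟩ := by
      rcases (hdc.1 : d.1 ≤ c.1).eq_or_lt with h | h
      · exact T.row_weak _ _ h le_rfl
      · exact (T.col_strict ⟨(d.1, c.2), hes⟩ ⟨c, hcs⟩ rfl h).le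
    exact h1.trans (h2.trans (hc.2 hcs))

theorem mem_lowShape {lam mu : YoungDiagram} {T : ColumnStrictTableau lam mu} {k : ℤ}
    {c : ℕ × ℕ} :
    c ∈ lowShape T k ↔ c ∈ lam ∧ ∀ hc : c ∈ skewCells lam mu, T.entry ⟨c, hc⟩ ≤ k := by
  rw [← YoungDiagram.mem_cells, lowShape, Finset.mem_filter, YoungDiagram.mem_cells]

theorem le_lowShape {lam mu : YoungDiagram} (h : mu ≤ lam) (T : ColumnStrictTableau lam mu)
    (k : ℤ) : mu ≤ lowShape T k := fun _ hc =>
  mem_lowShape.2 ⟨h hc, fun hc' => absurd hc (mem_skewCells.1 hc').2⟩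

theorem finite_setOf_le (lam : YoungDiagram) : {nu : YoungDiagram | nu ≤ lam}.Finite := by
  refine Set.Finite.of_injOn (f := YoungDiagram.cells) (t := (lam.cells.powerset : Set _))
    (fun nu hnu => ?_) (fun nu _ nu' _ h => YoungDiagram.ext h) (Finset.finite_toSet _)
  simpa using YoungDiagram.cells_subset_iff.2 hnu

/-- The diagrams `nu ≤ lam` such that `lam - nu` is a horizontal strip. -/
noncomputable def stripComplements (lam : YoungDiagram) : Finset YoungDiagram :=
  Set.Finite.toFinset (s := {nu | nu ≤ lam ∧ ∀ i j, (i + 1, j) ∈ lam → (i, j) ∈ nu})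
    ((finite_setOf_le lam).subset fun _ h => h.1)

theorem mem_stripComplements {lam nu : YoungDiagram} :
    nu ∈ stripComplements lam ↔ nu ≤ lam ∧ ∀ i j, (i + 1, j) ∈ lam → (i, j) ∈ nu := by
  simp [stripComplements]

theorem lowShape_mem_stripComplements {lam mu : YoungDiagram} {lo k : ℤ}
    {T : ColumnStrictTableau lam mu} (hT : T ∈ boundedTableaux lam mu lo (k + 1)) :
    lowShape T k ∈ stripComplements lam := by
  refine mem_stripComplements.2 ⟨fun c hc => (mem_lowShape.1 hc).1, fun i j hij => ?_⟩
  have hle : ((i, j) : ℕ × ℕ) ≤ (i + 1, j) := ⟨Nat.le_succ i, le_rfl⟩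
  refine mem_lowShape.2 ⟨lam.isLowerSet hle hij, fun hc => ?_⟩
  have hc' : (i + 1, j) ∈ skewCells lam mu :=
    mem_skewCells.2 ⟨hij, fun h => (mem_skewCells.1 hc).2 (mu.isLowerSet hle h)⟩
  have h1 := T.col_strict ⟨(i, j), hc⟩ ⟨(i + 1, j), hc'⟩ rfl (Nat.lt_succ_self i)
  have h2 := (mem_boundedTableaux.1 hT ⟨(i + 1, j), hc'⟩).2
  omega

theorem weight_eq_prod {lam mu : YoungDiagram} (T : ColumnStrictTableau lam mu) (t : ℕ × ℕ → ℤ)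
    (ht : ∀ c, T.entry c = t c.1) :
    weight T = ∏ c ∈ skewCells lam mu, cellWeight (t c) ((c.2 : ℤ) - c.1) := by
  rw [← Finset.prod_coe_sort, weight]
  refine Finset.prod_congr rfl fun c _ => ?_
  rw [ht c, cellWeight, add_sub_assoc]

/-- The entries of a tableau of shape `nu - mu`, extended by the value `k` to all other cells. -/
noncomputable def extendEntry {nu mu : YoungDiagram} (T : ColumnStrictTableau nu mu) (k : ℤ)
    (c : ℕ × ℕ) : ℤ :=
  if hc : c ∈ skewCells nu mu then T.entry ⟨c, hc⟩ else k

theorem extendEntry_of_mem {nu mu : YoungDiagram} (T : ColumnStrictTableau nu mu) (k : ℤ)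
    {c : ℕ × ℕ} (hc : c ∈ skewCells nu mu) : extendEntry T k c = T.entry ⟨c, hc⟩ := dif_pos hc

theorem extendEntry_of_notMem {nu mu : YoungDiagram} (T : ColumnStrictTableau nu mu) (k : ℤ)
    {c : ℕ × ℕ} (hc : c ∉ skewCells nu mu) : extendEntry T k c = k := dif_neg hc

/-- Filling the horizontal strip `lam - nu` with the entry `k + 1`. -/
noncomputable def extendTableau {lam nu mu : YoungDiagram} (hnu : nu ∈ stripComplements lam)
    {k : ℤ} (T : ColumnStrictTableau nu mu) (hT : ∀ c, T.entry c ≤ k) :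
    ColumnStrictTableau lam mu where
  entry c := extendEntry T (k + 1) c.1
  row_weak := by
    rintro ⟨c, hc⟩ ⟨d, hd⟩ h1 h2
    simp only at h1 h2 ⊢
    by_cases hdn : d ∈ skewCells nu mu
    · have hcn : c ∈ skewCells nu mu := mem_skewCells.2
        ⟨nu.isLowerSet (show c ≤ d from ⟨h1.le, h2⟩) (mem_skewCells.1 hdn).1,
          (mem_skewCells.1 hc).2⟩
      rw [extendEntry_of_mem _ _ hdn, extendEntry_of_mem _ _ hcn]
      exact T.row_weak _ _ h1 h2
    · rw [extendEntry_of_notMem _ _ hdn]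
      by_cases hcn : c ∈ skewCells nu mu
      · rw [extendEntry_of_mem _ _ hcn]
        exact (hT _).trans (by omega)
      · rw [extendEntry_of_notMem _ _ hcn]
  col_strict := by
    rintro ⟨c, hc⟩ ⟨d, hd⟩ h1 h2
    simp only at h1 h2 ⊢
    -- The strip condition puts the upper of two cells of a column in `nu`, so `k + 1` never repeats
    -- in a column.
    have hcn : c ∈ skewCells nu mu := by
      refine mem_skewCells.2 ⟨?_, (mem_skewCells.1 hc).2⟩
      refine (mem_stripComplements.1 hnu).2 c.1 c.2 (lam.isLowerSet ?_ (mem_skewCells.1 hd).1)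
      exact ⟨h2, h1.le⟩
    rw [extendEntry_of_mem _ _ hcn]
    by_cases hdn : d ∈ skewCells nu mu
    · rw [extendEntry_of_mem _ _ hdn]
      exact T.col_strict _ _ h1 h2
    · rw [extendEntry_of_notMem _ _ hdn]
      exact (hT _).trans_lt (by omega)

theorem skewCells_mono {lam nu mu : YoungDiagram} (h : nu ≤ lam) :
    skewCells nu mu ⊆ skewCells lam mu := fun _ hc =>
  mem_skewCells.2 ⟨h (mem_skewCells.1 hc).1, (mem_skewCells.1 hc).2⟩

/-- The restriction of a tableau to a smaller shape. -/
def restrictTableau {lam nu mu : YoungDiagram} (h : nu ≤ lam) (T : ColumnStrictTableau lam mu) :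
    ColumnStrictTableau nu mu where
  entry c := T.entry ⟨c.1, skewCells_mono h c.2⟩
  row_weak _ _ h1 h2 := T.row_weak _ _ h1 h2
  col_strict _ _ h1 h2 := T.col_strict _ _ h1 h2

theorem weight_extendTableau {lam nu mu : YoungDiagram} (hnu : nu ∈ stripComplements lam)
    (hmu : mu ≤ nu) {k : ℤ} (T : ColumnStrictTableau nu mu) (hT : ∀ c, T.entry c ≤ k) :
    weight (extendTableau hnu T hT) =
      (∏ c ∈ skewCells lam nu, cellWeight (k + 1) ((c.2 : ℤ) - c.1)) * weight T := by
  have hlam := (mem_stripComplements.1 hnu).1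
  rw [weight_eq_prod (extendTableau hnu T hT) (extendEntry T (k + 1)) fun _ => rfl,
    weight_eq_prod T (extendEntry T (k + 1)) fun c => (extendEntry_of_mem _ _ c.2).symm]
  have hunion : skewCells lam mu = skewCells lam nu ∪ skewCells nu mu := by
    ext c
    simp only [Finset.mem_union, mem_skewCells]
    have h1 : c ∈ nu → c ∈ lam := fun h => hlam h
    have h2 : c ∈ mu → c ∈ nu := fun h => hmu h
    tauto
  have hdisj : Disjoint (skewCells lam nu) (skewCells nu mu) :=
    Finset.disjoint_left.2 fun c h1 h2 => (mem_skewCells.1 h1).2 (mem_skewCells.1 h2).1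
  rw [hunion, Finset.prod_union hdisj]
  congr 1
  refine Finset.prod_congr rfl fun c hc => ?_
  rw [extendEntry_of_notMem _ _ fun h => (mem_skewCells.1 hc).2 (mem_skewCells.1 h).1]

/-- Restriction to `nu` and filling the strip with `k + 1` are mutually inverse. -/
theorem sum_weight_fiber {lam nu mu : YoungDiagram} (hnu : nu ∈ stripComplements lam)
    (hmu : mu ≤ nu) {lo k : ℤ} (hk : lo ≤ k) [DecidableEq YoungDiagram] :
    ∑ T ∈ boundedTableaux lam mu lo (k + 1) with lowShape T k = nu, weight T =
      (∏ c ∈ skewCells lam nu, cellWeight (k + 1) ((c.2 : ℤ) - c.1)) *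
        ∑ T ∈ boundedTableaux nu mu lo k, weight T := by
  have hlam := (mem_stripComplements.1 hnu).1
  have hle : ∀ T ∈ boundedTableaux nu mu lo k, ∀ c, T.entry c ≤ k := fun T hT c =>
    (mem_boundedTableaux.1 hT c).2
  rw [Finset.mul_sum]
  symm
  refine Finset.sum_bij (fun T hT => extendTableau hnu T (hle T hT)) ?_ ?_ ?_
    fun T hT => (weight_extendTableau hnu hmu T (hle T hT)).symm
  · intro T hT
    refine Finset.mem_filter.2 ⟨mem_boundedTableaux.2 fun c => ?_, ?_⟩
    · change lo < extendEntry T (k + 1) c.1 ∧ extendEntry T (k + 1) c.1 ≤ k + 1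
      by_cases hc : c.1 ∈ skewCells nu mu
      · rw [extendEntry_of_mem _ _ hc]
        have := mem_boundedTableaux.1 hT ⟨c.1, hc⟩
        omega
      · rw [extendEntry_of_notMem _ _ hc]
        omega
    · refine YoungDiagram.ext (Finset.ext fun c => ?_)
      rw [YoungDiagram.mem_cells, YoungDiagram.mem_cells, mem_lowShape]
      change (c ∈ lam ∧ ∀ hc : c ∈ skewCells lam mu, extendEntry T (k + 1) c ≤ k) ↔ c ∈ nu
      constructor
      · rintro ⟨hc, hck⟩
        by_contra hcn
        have := hck (mem_skewCells.2 ⟨hc, fun h => hcn (hmu h)⟩)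
        rw [extendEntry_of_notMem _ _ fun h => hcn (mem_skewCells.1 h).1] at this
        omega
      · intro hc
        refine ⟨hlam hc, fun hcs => ?_⟩
        rw [extendEntry_of_mem _ _ (mem_skewCells.2 ⟨hc, (mem_skewCells.1 hcs).2⟩)]
        exact hle T hT _
  · intro T hT T' hT' h
    refine ColumnStrictTableau.ext_entry fun c => ?_
    have := congrFun (congrArg ColumnStrictTableau.entry h) ⟨c.1, skewCells_mono hlam c.2⟩
    change extendEntry T (k + 1) c.1 = extendEntry T' (k + 1) c.1 at this
    rwa [extendEntry_of_mem _ _ c.2, extendEntry_of_mem _ _ c.2] at this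
  · intro T hT
    obtain ⟨hT, hshape⟩ := Finset.mem_filter.1 hT
    have hiff : ∀ c (hc : c ∈ skewCells lam mu), c ∈ nu ↔ T.entry ⟨c, hc⟩ ≤ k := by
      intro c hc
      rw [← hshape, mem_lowShape]
      exact ⟨fun h => h.2 hc, fun h => ⟨(mem_skewCells.1 hc).1, fun _ => h⟩⟩
    refine ⟨restrictTableau hlam T, mem_boundedTableaux.2 fun c => ⟨?_, ?_⟩, ?_⟩
    · exact (mem_boundedTableaux.1 hT ⟨c.1, skewCells_mono hlam c.2⟩).1
    · exact (hiff c.1 (skewCells_mono hlam c.2)).1 (mem_skewCells.1 c.2).1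
    · refine ColumnStrictTableau.ext_entry fun c => ?_
      change extendEntry (restrictTableau hlam T) (k + 1) c.1 = T.entry c
      by_cases hc : c.1 ∈ nu
      · rw [extendEntry_of_mem _ _ (mem_skewCells.2 ⟨hc, (mem_skewCells.1 c.2).2⟩)]
        rfl
      · rw [extendEntry_of_notMem _ _ fun h => hc (mem_skewCells.1 h).1]
        have h1 := (mem_boundedTableaux.1 hT c).2
        have h2 := mt (hiff c.1 c.2).2 hc
        change ¬ T.entry c ≤ k at h2
        omega

theorem sum_weight_boundedTableaux_succ {lam mu : YoungDiagram} (hmu : mu ≤ lam) {lo k : ℤ}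
    (hk : lo ≤ k) [DecidableRel fun mu nu : YoungDiagram => mu ≤ nu] :
    ∑ T ∈ boundedTableaux lam mu lo (k + 1), weight T =
      ∑ nu ∈ stripComplements lam,
        (∏ c ∈ skewCells lam nu, cellWeight (k + 1) ((c.2 : ℤ) - c.1)) *
          if mu ≤ nu then ∑ T ∈ boundedTableaux nu mu lo k, weight T else 0 := by
  classical
  rw [← Finset.sum_fiberwise_of_maps_to (g := fun T => lowShape T k)
    fun T hT => lowShape_mem_stripComplements hT]
  refine Finset.sum_congr rfl fun nu hnu => ?_
  split_ifs with h
  · exact sum_weight_fiber hnu h hk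
  · rw [mul_zero]
    refine Finset.sum_eq_zero fun T hT => absurd ?_ h
    rw [← (Finset.mem_filter.1 hT).2]
    exact le_lowShape hmu T k

/-! ### Diagrams and row lengths -/

theorem rowLen_eq_zero {lam : YoungDiagram} {m i : ℕ} (h : lam.colLen 0 ≤ m) (hi : m ≤ i) :
    lam.rowLen i = 0 := by
  by_contra hne
  have h1 : (i, 0) ∈ lam := YoungDiagram.mem_iff_lt_rowLen.2 (Nat.pos_of_ne_zero hne)
  have h2 := YoungDiagram.mem_iff_lt_colLen.1 h1
  omega

theorem le_iff_rowLen_le {lam mu : YoungDiagram} {m : ℕ} (h : mu.colLen 0 ≤ m) :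
    mu ≤ lam ↔ ∀ i : Fin m, mu.rowLen i ≤ lam.rowLen i := by
  constructor
  · intro hle i
    by_contra! hlt
    exact lt_irrefl _ (YoungDiagram.mem_iff_lt_rowLen.1
      (hle (YoungDiagram.mem_iff_lt_rowLen.2 hlt)))
  · rintro hle ⟨i, j⟩ hc
    have hj : j < mu.rowLen i := YoungDiagram.mem_iff_lt_rowLen.1 hc
    have hi : i < m := by
      by_contra! hi
      rw [rowLen_eq_zero h hi] at hj
      omega
    exact YoungDiagram.mem_iff_lt_rowLen.2 (hj.trans_le (hle ⟨i, hi⟩))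

theorem prod_skewCells {M : Type*} [CommMonoid M] {lam nu : YoungDiagram} {m : ℕ}
    (hlam : lam.colLen 0 ≤ m) (f : ℕ × ℕ → M) :
    ∏ c ∈ skewCells lam nu, f c =
      ∏ i : Fin m, ∏ j ∈ Finset.Ico (nu.rowLen i) (lam.rowLen i), f (i, j) := by
  rw [Fin.prod_univ_eq_prod_range
    (fun i => ∏ j ∈ Finset.Ico (nu.rowLen i) (lam.rowLen i), f (i, j)) m]
  rw [Finset.prod_sigma' (Finset.range m) (fun i => Finset.Ico (nu.rowLen i) (lam.rowLen i))
    (fun i j => f (i, j))]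
  refine Finset.prod_bij' (fun c _ => ⟨c.1, c.2⟩) (fun s _ => (s.1, s.2)) ?_ ?_
    (fun _ _ => rfl) (fun _ _ => rfl) (fun _ _ => rfl)
  · rintro ⟨i, j⟩ hc
    obtain ⟨h1, h2⟩ := mem_skewCells.1 hc
    rw [YoungDiagram.mem_iff_lt_rowLen] at h1 h2
    simp only [Finset.mem_sigma, Finset.mem_range, Finset.mem_Ico]
    refine ⟨?_, by omega, h1⟩
    by_contra! hi
    rw [rowLen_eq_zero hlam hi] at h1
    omega
  · rintro ⟨i, j⟩ hc
    simp only [Finset.mem_sigma, Finset.mem_range, Finset.mem_Ico] at hc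
    rw [mem_skewCells, YoungDiagram.mem_iff_lt_rowLen, YoungDiagram.mem_iff_lt_rowLen]
    exact ⟨hc.2.2, not_lt.2 hc.2.1⟩

/-- The diagram contained in `lam` whose row `i` is bounded by `r 0, …, r i`. -/
def cutDiagram (lam : YoungDiagram) {m : ℕ} (r : Fin m → ℕ) : YoungDiagram where
  cells := lam.cells.filter fun c => ∀ i : Fin m, (i : ℕ) ≤ c.1 → c.2 < r i
  isLowerSet := by
    intro c d hdc hc
    simp only [Finset.coe_filter, Set.mem_ofPred_eq, YoungDiagram.mem_cells] at hc ⊢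
    exact ⟨lam.isLowerSet hdc hc.1, fun i hi =>
      (show d.2 ≤ c.2 from hdc.2).trans_lt (hc.2 i (hi.trans hdc.1))⟩

theorem mem_cutDiagram {lam : YoungDiagram} {m : ℕ} {r : Fin m → ℕ} {c : ℕ × ℕ} :
    c ∈ cutDiagram lam r ↔ c ∈ lam ∧ ∀ i : Fin m, (i : ℕ) ≤ c.1 → c.2 < r i := by
  rw [← YoungDiagram.mem_cells, cutDiagram, Finset.mem_filter, YoungDiagram.mem_cells]

/-- Interlacing gives `r i ≤ λ_i ≤ λ_{i'+1} ≤ r i'` for `i' < i`, so the bounds from earlier rows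
are not active. -/
theorem rowLen_cutDiagram {lam : YoungDiagram} {m : ℕ} {r : Fin m → ℕ}
    (hr : r ∈ Fintype.piFinset fun i : Fin m =>
      Finset.Icc (lam.rowLen (i + 1)) (lam.rowLen i)) (i : Fin m) :
    (cutDiagram lam r).rowLen i = r i := by
  simp only [Fintype.mem_piFinset, Finset.mem_Icc] at hr
  refine eq_of_forall_lt_iff fun j => ?_
  rw [← YoungDiagram.mem_iff_lt_rowLen, mem_cutDiagram, YoungDiagram.mem_iff_lt_rowLen]
  constructor
  · exact fun h => h.2 i le_rfl
  · refine fun h => ⟨h.trans_le (hr i).2, fun i' hi' => ?_⟩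
    rcases hi'.eq_or_lt with h' | h'
    · rwa [Fin.ext h']
    · exact (h.trans_le (hr i).2).trans_le ((lam.rowLen_anti (i' + 1) i h').trans (hr i').1)

theorem sum_stripComplements {M : Type*} [AddCommMonoid M] {lam : YoungDiagram} {m : ℕ}
    (hlam : lam.colLen 0 ≤ m) (f : (Fin m → ℕ) → M) :
    ∑ r ∈ Fintype.piFinset fun i : Fin m => Finset.Icc (lam.rowLen (i + 1)) (lam.rowLen i), f r =
      ∑ nu ∈ stripComplements lam, f fun i => nu.rowLen i := by
  symm
  have hcol : ∀ nu ∈ stripComplements lam, nu.colLen 0 ≤ m := by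
    intro nu hnu
    by_contra! hlt
    have h1 : (m, 0) ∈ lam :=
      (mem_stripComplements.1 hnu).1 (YoungDiagram.mem_iff_lt_colLen.2 hlt)
    have := YoungDiagram.mem_iff_lt_colLen.1 h1
    omega
  refine Finset.sum_bij (fun nu _ i => nu.rowLen i) ?_ ?_ ?_ fun _ _ => rfl
  · intro nu hnu
    obtain ⟨h1, h2⟩ := mem_stripComplements.1 hnu
    simp only [Fintype.mem_piFinset, Finset.mem_Icc]
    refine fun i => ⟨?_, (le_iff_rowLen_le (hcol nu hnu)).1 h1 i⟩
    by_contra! hlt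
    exact lt_irrefl _ (YoungDiagram.mem_iff_lt_rowLen.1
      (h2 i _ (YoungDiagram.mem_iff_lt_rowLen.2 hlt)))
  · intro nu hnu nu' hnu' h
    exact le_antisymm ((le_iff_rowLen_le (hcol nu hnu)).2 fun i => (congrFun h i).le)
      ((le_iff_rowLen_le (hcol nu' hnu')).2 fun i => (congrFun h i).ge)
  · intro r hr
    refine ⟨cutDiagram lam r, mem_stripComplements.2
      ⟨fun c hc => (mem_cutDiagram.1 hc).1, fun i j hij => ?_⟩,
      funext fun i => rowLen_cutDiagram hr i⟩
    have hi : i < m := by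
      have := (YoungDiagram.mem_iff_lt_colLen.1 (lam.isLowerSet
        (show ((i + 1, 0) : ℕ × ℕ) ≤ (i + 1, j) from ⟨le_rfl, Nat.zero_le j⟩) hij))
      omega
    rw [YoungDiagram.mem_iff_lt_rowLen, rowLen_cutDiagram hr ⟨i, hi⟩]
    have h1 := (Finset.mem_Icc.1 (Fintype.mem_piFinset.1 hr ⟨i, hi⟩)).1
    exact (YoungDiagram.mem_iff_lt_rowLen.1 hij).trans_le h1

/-! ### The identity for finitely many entries -/

/-- If `μ_k > λ_k`, then `λ_i - i ≤ λ_k - k < μ_k - k ≤ μ_j - j` for `j ≤ k ≤ i`, giving the block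
of zeros. -/
theorem det_eq_zero_of_not_le {R : Type*} [CommRing R] {lam mu : YoungDiagram} {m : ℕ}
    (hmu : mu.colLen 0 ≤ m) (h : ¬ mu ≤ lam) (F : ℤ → ℤ → R) (hF : ∀ p q, q < p → F p q = 0) :
    (Matrix.of fun i j : Fin m =>
      F ((mu.rowLen j : ℤ) - (j : ℕ)) ((lam.rowLen i : ℤ) - (i : ℕ))).det = 0 := by
  rw [le_iff_rowLen_le hmu] at h
  push Not at h
  obtain ⟨k, hk⟩ := h
  refine det_eq_zero_of_block _ k fun i j hi hj => hF _ _ ?_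
  have h1 := lam.rowLen_anti k i hi
  have h2 := mu.rowLen_anti j k hj
  have h3 : (j : ℕ) ≤ k := hj
  have h4 : (k : ℕ) ≤ i := hi
  omega

theorem det_truncH_zero (lo : ℤ) {lam mu : YoungDiagram} {m : ℕ} (hlam : lam.colLen 0 ≤ m)
    (hle : mu ≤ lam) :
    (Matrix.of fun i j : Fin m =>
      truncH lo 0 ((mu.rowLen j : ℤ) - (j : ℕ)) ((lam.rowLen i : ℤ) - (i : ℕ))).det =
      ∑ T ∈ boundedTableaux lam mu lo lo, weight T := by
  by_cases h : lam ≤ mu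
  · obtain rfl := le_antisymm h hle
    have hempty : skewCells lam lam = ∅ := Finset.sdiff_self _
    have hno : ∀ c, c ∉ skewCells lam lam := fun c hc => Finset.notMem_empty c (hempty ▸ hc)
    have huniv : boundedTableaux lam lam lo lo =
        {⟨fun c => absurd c.2 (hno _), fun c => absurd c.2 (hno _), fun c => absurd c.2 (hno _)⟩} := by
      refine Finset.eq_singleton_iff_unique_mem.2 ⟨mem_boundedTableaux.2 fun c => ?_,
        fun T _ => ColumnStrictTableau.ext_entry fun c => ?_⟩
      all_goals exact absurd c.2 (hno _)
    rw [huniv, Finset.sum_singleton, weight_eq_prod _ (fun _ => 0) fun c =>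
      absurd c.2 (hno _), hempty, Finset.prod_empty]
    refine (congrArg Matrix.det ?_).trans Matrix.det_one
    ext1 i j
    rw [Matrix.of_apply, truncH_zero, Matrix.one_apply]
    refine if_congr ?_ rfl rfl
    constructor
    · intro hij
      rcases lt_trichotomy i j with hlt | heq | hlt
      · have h1 := lam.rowLen_anti i j hlt.le
        have h2 : (i : ℕ) < j := hlt
        omega
      · exact heq
      · have h1 := lam.rowLen_anti j i hlt.le
        have h2 : (j : ℕ) < i := hlt
        omega
    · rintro rfl
      rfl
  · obtain ⟨c, hc, hc'⟩ : ∃ c, c ∈ lam ∧ c ∉ mu := by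
      by_contra! hcon
      exact h fun c hc => hcon c hc
    have hempty : boundedTableaux lam mu lo lo = ∅ := by
      refine Finset.eq_empty_of_forall_notMem fun T hT => ?_
      have := mem_boundedTableaux.1 hT ⟨c, mem_skewCells.2 ⟨hc, hc'⟩⟩
      omega
    -- Here it is `lam ≤ mu` that fails, so transposition exchanges the roles of the two shapes; the
    -- Kronecker delta is symmetric.
    rw [hempty, Finset.sum_empty, ← Matrix.det_transpose]
    refine (congrArg Matrix.det ?_).trans (det_eq_zero_of_not_le hlam h
      (fun p q => if q = p then (1 : Ser) else 0) fun p q hpq => if_neg hpq.ne)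
    ext1 i j
    simp only [Matrix.transpose_apply, Matrix.of_apply, truncH_zero]

theorem det_truncH (lo : ℤ) (n : ℕ) {lam mu : YoungDiagram} {m : ℕ} (hlam : lam.colLen 0 ≤ m)
    (hmu : mu.colLen 0 ≤ m) (hle : mu ≤ lam) :
    (Matrix.of fun i j : Fin m =>
      truncH lo n ((mu.rowLen j : ℤ) - (j : ℕ)) ((lam.rowLen i : ℤ) - (i : ℕ))).det =
      ∑ T ∈ boundedTableaux lam mu lo (lo + n), weight T := by
  classical
  induction n generalizing lam with
  | zero => simpa using det_truncH_zero lo hlam hle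
  | succ n ih =>
    rw [det_truncH_succ lo n m (fun j => (mu.rowLen j : ℤ) - (j : ℕ)) (fun j => by omega)
      lam.rowLen (fun i j hij => lam.rowLen_anti i j hij) (rowLen_eq_zero hlam le_rfl),
      Nat.cast_succ, ← add_assoc, sum_weight_boundedTableaux_succ hle (by omega),
      sum_stripComplements hlam (fun r : Fin m → ℕ =>
        (∏ i : Fin m, ∏ c ∈ Finset.Ico (r i) (lam.rowLen i),
          cellWeight (lo + n + 1) ((c : ℤ) - (i : ℕ))) *
          (Matrix.of fun i j : Fin m =>
            truncH lo n ((mu.rowLen j : ℤ) - (j : ℕ)) ((r i : ℤ) - (i : ℕ))).det)]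
    refine Finset.sum_congr rfl fun nu hnu => ?_
    rw [prod_skewCells hlam]
    congr 1
    split_ifs with h
    · refine ih ?_ h
      by_contra! hlt
      have := YoungDiagram.mem_iff_lt_colLen.1
        ((mem_stripComplements.1 hnu).1 (YoungDiagram.mem_iff_lt_colLen.2 hlt))
      omega
    · exact det_eq_zero_of_not_le hmu h _ fun p q hpq => truncH_of_lt lo n hpq

/-! ### Passage to the limit -/

theorem tendsto_Ioc_atTop {l u : ℕ → ℤ} (hl : Tendsto l atTop atBot) (hu : Tendsto u atTop atTop) :
    Tendsto (fun N => Finset.Ioc (l N) (u N)) atTop atTop := by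
  refine tendsto_atTop.2 fun S => ?_
  have hS := (eventually_all_finset S).2 fun i _ =>
    (hl.eventually_lt_atBot i).and (hu.eventually_ge_atTop i)
  filter_upwards [hS] with N hN i hi
  exact Finset.mem_Ioc.2 (hN i hi)

theorem tendsto_truncH (p q : ℤ) :
    Tendsto (fun N : ℕ => truncH (-N) (2 * N) p q) atTop (𝓝 (h (q - p))) := by
  by_cases hpq : p ≤ q
  · have hN : Tendsto (fun N : ℕ => (N : ℤ)) atTop atTop := tendsto_natCast_atTop_atTop
    have hN' : Tendsto (fun N : ℕ => -(N : ℤ)) atTop atBot := tendsto_neg_atTop_atBot.comp hN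
    have hx := multipliable_xFactor.hasProd
    have ha := multipliable_aFactor.hasProd
    rw [HasProd, SummationFilter.unconditional_filter] at hx ha
    have h1 := hx.comp (tendsto_Ioc_atTop hN' hN)
    have h2 := ha.comp (tendsto_Ioc_atTop (tendsto_atBot_add_const_right _ p hN')
      (tendsto_atTop_add_const_right _ (q - 1) hN))
    have h3 := (PowerSeries.WithPiTopology.tendsto_iff_coeff_tendsto _ _ _ _).1 (h1.mul h2)
      (q - p).toNat
    rw [h, if_pos (by omega), genSeries]
    refine h3.congr fun N => ?_
    rw [truncH, if_pos hpq, truncGenSeries]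
    have e1 : -(N : ℤ) + (2 * N : ℕ) = N := by push_cast; ring
    rw [e1, add_sub_assoc]
    rfl
  · rw [h, if_neg (by omega)]
    refine tendsto_const_nhds.congr fun N => ?_
    rw [truncH_of_lt _ _ (by omega)]

theorem tendsto_sum_weight {lam mu : YoungDiagram} {m : ℕ} (hlam : lam.colLen 0 ≤ m)
    (hmu : mu.colLen 0 ≤ m) (hle : mu ≤ lam) :
    Tendsto (fun N : ℕ => ∑ T ∈ boundedTableaux lam mu (-N) N, weight T) atTop
      (𝓝 (skewSchur m lam mu)) := by
  have hM : Tendsto (fun N : ℕ => (Matrix.of fun i j : Fin m =>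
      truncH (-N) (2 * N) ((mu.rowLen j : ℤ) - (j : ℕ)) ((lam.rowLen i : ℤ) - (i : ℕ)))) atTop
      (𝓝 (Matrix.of fun i j : Fin m =>
        h ((lam.rowLen i : ℤ) - (mu.rowLen j : ℤ) - (i : ℕ) + (j : ℕ)))) := by
    refine tendsto_pi_nhds.2 fun i => tendsto_pi_nhds.2 fun j => ?_
    have e : (lam.rowLen i : ℤ) - (mu.rowLen j : ℤ) - (i : ℕ) + (j : ℕ) =
        ((lam.rowLen i : ℤ) - (i : ℕ)) - ((mu.rowLen j : ℤ) - (j : ℕ)) := by ring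
    simp only [Matrix.of_apply]
    rw [e]
    exact tendsto_truncH _ _
  have hdet : Continuous fun A : Matrix (Fin m) (Fin m) Ser => A.det := continuous_id.matrix_det
  refine ((hdet.tendsto _).comp hM).congr fun N => ?_
  rw [Function.comp_apply, det_truncH (-(N : ℤ)) (2 * N) hlam hmu hle]
  have e1 : -(N : ℤ) + (2 * N : ℕ) = N := by push_cast; ring
  rw [e1]

theorem coeff_X_mul_eq_zero {σ R : Type*} [CommSemiring R] {d : σ →₀ ℕ} {v : σ} (hv : d v = 0)
    (f : MvPowerSeries σ R) : MvPowerSeries.coeff d (MvPowerSeries.X v * f) = 0 := by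
  rw [MvPowerSeries.X, MvPowerSeries.coeff_monomial_mul, if_neg]
  intro hle
  have := hle v
  simp [hv] at this

theorem coeff_weight_eq_zero {lam mu : YoungDiagram} (T : ColumnStrictTableau lam mu)
    (d : ℤ ⊕ ℤ →₀ ℕ) (s : {c : ℕ × ℕ // c ∈ skewCells lam mu}) (hx : d (Sum.inl (T.entry s)) = 0)
    (ha : d (Sum.inr (T.entry s + (s.1.2 : ℤ) - (s.1.1 : ℤ))) = 0) :
    MvPowerSeries.coeff d (weight T) = 0 := by
  rw [weight, ← Finset.mul_prod_erase _ _ (Finset.mem_univ s), add_mul, map_add, x, a,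
    coeff_X_mul_eq_zero hx, coeff_X_mul_eq_zero ha, add_zero]

theorem exists_coeff_weight_eq_zero (lam mu : YoungDiagram) (d : ℤ ⊕ ℤ →₀ ℕ) :
    ∃ N₀ : ℕ, ∀ N : ℕ, N₀ ≤ N → ∀ T : ColumnStrictTableau lam mu,
      T ∉ boundedTableaux lam mu (-N) N → MvPowerSeries.coeff d (weight T) = 0 := by
  obtain ⟨B, hB⟩ : ∃ B : ℕ, ∀ v ∈ d.support, (Sum.elim id id v : ℤ).natAbs ≤ B :=
    ⟨d.support.sup fun v => (Sum.elim id id v : ℤ).natAbs, fun v hv =>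
      Finset.le_sup (f := fun v => (Sum.elim id id v : ℤ).natAbs) hv⟩
  obtain ⟨C, hC⟩ : ∃ C : ℕ, ∀ c ∈ skewCells lam mu, c.1 + c.2 ≤ C :=
    ⟨(skewCells lam mu).sup fun c => c.1 + c.2, fun c hc =>
      Finset.le_sup (f := fun c : ℕ × ℕ => c.1 + c.2) hc⟩
  -- `B` bounds the indices of the variables in `d`, and `C` the absolute contents. An entry outside
  -- `(-N, N]` has absolute value at least `N > B + C`, so neither variable of its cell occurs in
  -- `d`.
  refine ⟨B + C + 1, fun N hN T hT => ?_⟩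
  rw [mem_boundedTableaux] at hT
  push Not at hT
  obtain ⟨s, hs⟩ := hT
  have hs' := hC s.1 s.2
  refine coeff_weight_eq_zero T d s ?_ ?_
  · by_contra hne
    have := hB _ (Finsupp.mem_support_iff.2 hne)
    simp only [Sum.elim_inl, id] at this
    omega
  · by_contra hne
    have := hB _ (Finsupp.mem_support_iff.2 hne)
    simp only [Sum.elim_inr, id] at this
    omega

theorem hasSum_weight {lam mu : YoungDiagram} {m : ℕ} (hlam : lam.colLen 0 ≤ m)
    (hmu : mu.colLen 0 ≤ m) (hle : mu ≤ lam) :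
    HasSum (fun T : ColumnStrictTableau lam mu => weight T) (skewSchur m lam mu) := by
  rw [HasSum, SummationFilter.unconditional_filter,
    MvPowerSeries.WithPiTopology.tendsto_iff_coeff_tendsto]
  intro d
  obtain ⟨N₀, hN₀⟩ := exists_coeff_weight_eq_zero lam mu d
  have hlim := (MvPowerSeries.WithPiTopology.tendsto_iff_coeff_tendsto _ _ _).1
    (tendsto_sum_weight hlam hmu hle) d
  -- Coefficients lie in the discrete ring `ℤ`, so convergence means being eventually constant.
  rw [nhds_discrete, tendsto_pure] at hlim
  obtain ⟨N, hN, hN'⟩ := (hlim.and (eventually_ge_atTop N₀)).exists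
  rw [← hN]
  refine tendsto_const_nhds.congr' ?_
  filter_upwards [eventually_ge_atTop (boundedTableaux lam mu (-N) N)] with S hS
  rw [map_sum, map_sum]
  exact Finset.sum_subset hS fun T _ hT => hN₀ N hN' T hT

end DoublyInfinite

theorem mainTheorem7 (lam mu : YoungDiagram) (m : ℕ)
    (hlam : lam.colLen 0 ≤ m) (hmu : mu.colLen 0 ≤ m) :
    (mu ≤ lam →
      HasSum (fun T : DoublyInfinite.ColumnStrictTableau lam mu => DoublyInfinite.weight T)
        (DoublyInfinite.skewSchur m lam mu)) ∧
    (¬ mu ≤ lam → DoublyInfinite.skewSchur m lam mu = 0) := by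
  refine ⟨DoublyInfinite.hasSum_weight hlam hmu, fun hle => ?_⟩
  refine (congrArg Matrix.det ?_).trans (DoublyInfinite.det_eq_zero_of_not_le hmu hle
    (fun p q => DoublyInfinite.h (q - p)) fun p q hpq => if_neg (by omega))
  ext1 i j
  simp only [Matrix.of_apply]
  congr 1
  ring
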